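/- Consider an open network of $J$ infinite-server queues, empty before time $0$. Batches arrive at the points $T_1<T_2<\cdots$ of a homogeneous Poisson process with rate $\lambda>0$. At time $T_i$, $\Sigma_{ij}$ customers arrive at queue $j$ ($j=1,\dots,J$), where the vectors $(\Sigma_{i1},\dots,\Sigma_{iJ})$ are independent copies of a random vector $\mathbf S=(S_1,\dots,S_J)$ with non-negative integer components. The $\ell$-th customer who enters queue $j$ at time $T_i$ is marked with a (measurable) stochastic process $X^j_{i,\ell}(t)$, $t\ge 0$, with $X^j_{i,\ell}(t)=k$ if that customer is in queue $k$ at time $T_i+t$, and with no value in $\{1,\dots,J\}$ if the customer is not in the network at that time; $P(X^j_{i,\ell}(t)=k)=q^j_k(t)$. The arrival process, the batch size vectors and all the processes $X^j_{i,\ell}$ are independent. Let $Q_j(t)=\sum_{k=1}^J q^j_k(t)$ be the probability that a customer who entered at queue $j$ is in the network a time $t$ after arriving, let $N_k(t)$ be the number of customers in queue $k$ at time $t$, and $\mathbf N(t)=(N_1(t),\dots,N_J(t))$. The network is called ergodic if $\mathbf N(t)$ converges in law, as $t\to\infty$, to a proper probability distribution $\pi$ on $\mathbb Z_{\ge0}^J$,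 that is, $P(\mathbf N(t)=\mathbf n)\to\pi(\mathbf n)$ for every $\mathbf n$. Let $W$ be the total time during which at least one customer of a given batch is present in the network. Suppose that the expected network occupation time $\int_0^\infty Q_j(\tau)\,d\tau$ is finite for each $j=1,\dots,J$, and that the mean total batch size $\mathbb E[S_1+\dots+S_J]$ is finite. Then the network is ergodic. Moreover, $$\mathbb E[W]\le\sum_{j=1}^J\mathbb E[S_j]\int_0^\infty Q_j(\tau)\,d\tau .$$ -/

import Mathlib

open MeasureTheory ProbabilityTheory Filter Topology
open scoped NNReal ENNReal

/-- The independent sources of randomness of a network with `J` queues: the interarrival times,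
the batch size vectors, and one route for each potential customer (`customer i j l` is the customer
number `l` of batch `i` among those that enter queue `j`; all indices start at `0`). -/
inductive RandomSource (J : ℕ) : Type
  | gap (i : ℕ)
  | batch (i : ℕ)
  | customer (i : ℕ) (j : Fin J) (l : ℕ)

/-- The time between consecutive points of a sequence of arrival times `T 0, T 1, …`
(the first one is counted from time `0`). -/
def interarrival {Ω : Type*} (T : ℕ → Ω → ℝ≥0) : ℕ → Ω → ℝ
  | 0, ω => T 0 ω
  | i + 1, ω => (T (i + 1) ω : ℝ) - T i ω

/-- The sigma-algebra generated by a single source of randomness. For a customer it is generated by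
the whole location process. -/
@[reducible]
def sourceSigma {Ω : Type*} {J : ℕ} (T : ℕ → Ω → ℝ≥0) (B : ℕ → Ω → Fin J → ℕ)
    (X : ℕ → Fin J → ℕ → ℝ≥0 → Ω → Option (Fin J)) : RandomSource J → MeasurableSpace Ω
  | .gap i => MeasurableSpace.comap (interarrival T i) inferInstance
  | .batch i => MeasurableSpace.comap (B i) inferInstance
  | .customer i j l => ⨆ s : ℝ≥0, MeasurableSpace.comap (X i j l s) ⊤

/-- An open network of `J` infinite-server queues, empty before time `0`, on the probability space
`(Ω, P)`. Batches arrive at the points of a homogeneous Poisson process with rate `rate`, batch size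
vectors have the law `p`, and `q j k t` is the probability that a customer who entered at queue `j`
is in queue `k` a time `t` after arriving. -/
structure BatchNetwork {Ω : Type*} [MeasurableSpace Ω] (P : Measure Ω) (J : ℕ) (rate : ℝ)
    (p : PMF (Fin J → ℕ)) (q : Fin J → Fin J → ℝ≥0 → ℝ≥0∞) where
  /-- the arrival time of the `i`-th batch -/
  T : ℕ → Ω → ℝ≥0
  /-- `B i ω j` is the number of customers of the `i`-th batch that arrive at queue `j` -/
  B : ℕ → Ω → Fin J → ℕ
  /-- `X i j l t ω` is the queue in which customer `l` of those that enter queue `j` with batch `i`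
  is at time `T i + t`; it is `none` if the customer is not in the network at that time -/
  X : ℕ → Fin J → ℕ → ℝ≥0 → Ω → Option (Fin J)
  measurable_T : ∀ i, Measurable (T i)
  measurable_B : ∀ i, Measurable (B i)
  /-- Each location at a fixed time is a random variable. -/
  measurable_X : ∀ i j l t k, MeasurableSet {ω | X i j l t ω = some k}
  /-- Each location process is jointly measurable in time and in its own randomness (as is every
  process with right-continuous, piecewise constant paths). -/
  jointly_measurable_X : ∀ i j l k,
    MeasurableSet[(inferInstance : MeasurableSpace ℝ≥0).prod (sourceSigma T B X (.customer i j l))]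
      {x : ℝ≥0 × Ω | X i j l x.1 x.2 = some k}
  /-- Interarrival times are exponential; with `indep` this makes the arrivals Poisson. -/
  law_gap : ∀ i, P.map (interarrival T i) = expMeasure rate
  law_batch : ∀ i n, P {ω | B i ω = n} = p n
  law_location : ∀ i j l t k, P {ω | X i j l t ω = some k} = q j k t
  indep : iIndep (sourceSigma T B X) P

namespace BatchNetwork

variable {Ω : Type*} [MeasurableSpace Ω] {P : Measure Ω} {J : ℕ} {rate : ℝ}
  {p : PMF (Fin J → ℕ)} {q : Fin J → Fin J → ℝ≥0 → ℝ≥0∞}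

/-- The number of customers of the `i`-th batch that are in queue `k` at time `T i + t`. -/
def batchCount (N : BatchNetwork P J rate p q) (i : ℕ) (k : Fin J) (t : ℝ≥0) (ω : Ω) : ℕ :=
  ∑ j : Fin J, ∑ l ∈ Finset.range (N.B i ω j), if N.X i j l t ω = some k then 1 else 0

/-- The number of customers in queue `k` at time `t`. -/
noncomputable def occupancy (N : BatchNetwork P J rate p q) (t : ℝ≥0) (k : Fin J) (ω : Ω) : ℝ≥0∞ :=
  ∑' i : ℕ, if N.T i ω ≤ t then (N.batchCount i k (t - N.T i ω) ω : ℝ≥0∞) else 0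

/-- The network is ergodic: as `t → ∞`, the vector of queue lengths at time `t` converges in law to
a proper (total mass one) probability distribution on `ℕ ^ J`. -/
def Ergodic (N : BatchNetwork P J rate p q) : Prop :=
  ∃ π : PMF (Fin J → ℕ), ∀ n : Fin J → ℕ,
    Tendsto (fun t : ℝ≥0 => P {ω | ∀ k, N.occupancy t k ω = (n k : ℝ≥0∞)}) atTop (𝓝 (π n))

/-- The total time during which at least one customer of the `i`-th batch is in the network. -/
noncomputable def batchOccupancyTime (N : BatchNetwork P J rate p q) (i : ℕ) (ω : Ω) : ℝ≥0∞ :=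
  volume {t : ℝ | 0 ≤ t ∧ ∃ j k : Fin J, ∃ l < N.B i ω j, N.X i j l t.toNNReal ω = some k}

end BatchNetwork

/-- The probability `Q j t` that a customer who entered at queue `j` is in the network a time `t`
after arriving. -/
noncomputable def networkTail {J : ℕ} (q : Fin J → Fin J → ℝ≥0 → ℝ≥0∞) (j : Fin J) (t : ℝ≥0) :
    ℝ≥0∞ :=
  ∑ k : Fin J, q j k t

/-- The expected network occupation time of a customer who entered at queue `j`, that is, the
integral of `Q j` over `(0, ∞)`. -/
noncomputable def meanNetworkTime {J : ℕ} (q : Fin J → Fin J → ℝ≥0 → ℝ≥0∞) (j : Fin J) : ℝ≥0∞ :=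
  ∫⁻ t in Set.Ioi (0 : ℝ), networkTail q j t.toNNReal

/-- The expected value of the number of customers of a batch that enter at queue `j`. -/
noncomputable def meanBatch {J : ℕ} (p : PMF (Fin J → ℕ)) (j : Fin J) : ℝ≥0∞ :=
  ∑' n : Fin J → ℕ, p n * (n j : ℝ≥0∞)

/-- The expected value of the total number of customers of a batch. -/
noncomputable def meanTotalBatch {J : ℕ} (p : PMF (Fin J → ℕ)) : ℝ≥0∞ :=
  ∑' n : Fin J → ℕ, p n * ((∑ j : Fin J, n j : ℕ) : ℝ≥0∞)

/-! ### Joint measurability in time and randomness -/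

section Measurability

variable {Ω : Type*} [MeasurableSpace Ω] {J : ℕ}

/-! Split at the first arrival: the queue vector at time `t` is the first batch at age `u = t - T 0`
plus the network of the later batches at time `u`. That network has the same parameters, and the law
of the queue vector depends on the parameters only (`occProb_eq`). So `f t = P(N(t) ∈ A)` and `h u`,
the probability that the sum of the two parts lies in `A`, satisfy a renewal equation
(`occProb_eq_lintegral`). As gaps are exponential, it is the integrated form of `f' = rate * (h -
f)`.

The sum differs from its second part only if the first batch is still present at age `u`, so `|h u -
f u|` is at most the mean number `e u` of customers of a batch present at age `u`
(`measure_batchVec_ne_zero_le`). Hence `|f t - f s| ≤ rate * ∫ e` over `[s, t]`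
(`abs_occProb_sub_le`). The hypotheses make `e` integrable on `(0, ∞)`, so `f` is Cauchy, uniformly
in `A`. Applied to finite sets of states, the uniformity keeps mass from escaping, and the limit is
a probability distribution (`exists_pmf_tendsto`).

The bound on the occupation time is a union bound over customers and queues, combined with
independence of batch sizes and routes and Tonelli's theorem. -/

theorem natCast_sum_range_eq_tsum (n : ℕ) (f : ℕ → ℕ) :
    ((∑ l ∈ Finset.range n, f l : ℕ) : ℝ≥0∞) = ∑' l, if l < n then (f l : ℝ≥0∞) else 0 := by
  rw [tsum_eq_sum (s := Finset.range n) (fun l hl => if_neg (by simpa using hl)), Nat.cast_sum]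
  exact Finset.sum_congr rfl fun l hl => (if_pos (by simpa using hl)).symm

theorem measurable_batch_location {B : Ω → Fin J → ℕ}
    {X : Fin J → ℕ → ℝ≥0 → Ω → Option (Fin J)} (hB : Measurable B)
    (hX : ∀ j l k, MeasurableSet {x : ℝ≥0 × Ω | X j l x.1 x.2 = some k}) (k : Fin J) :
    Measurable fun x : ℝ≥0 × Ω => ((∑ j : Fin J, ∑ l ∈ Finset.range (B x.2 j),
      if X j l x.1 x.2 = some k then 1 else 0 : ℕ) : ℝ≥0∞) := by
  simp_rw [Nat.cast_sum (R := ℝ≥0∞) Finset.univ, natCast_sum_range_eq_tsum]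
  refine Finset.measurable_sum _ fun j _ => Measurable.tsum fun l => ?_
  refine Measurable.ite ?_ ?_ measurable_const
  · have h : Measurable fun x : ℝ≥0 × Ω => B x.2 j :=
      (measurable_pi_apply j).comp (hB.comp measurable_snd)
    exact h (measurableSet_Ioi (a := l))
  · simp only [Nat.cast_ite, Nat.cast_one, Nat.cast_zero]
    exact Measurable.ite (hX j l k) measurable_const measurable_const

theorem measurable_tsum_delayed {T : ℕ → Ω → ℝ≥0} {c : ℕ → ℝ≥0 → Ω → ℝ≥0∞}
    (hT : ∀ i, Measurable (T i)) (hc : ∀ i, Measurable fun x : ℝ≥0 × Ω => c i x.1 x.2) :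
    Measurable fun x : ℝ≥0 × Ω =>
      ∑' i, if T i x.2 ≤ x.1 then c i (x.1 - T i x.2) x.2 else 0 := by
  refine Measurable.tsum fun i => Measurable.ite ?_ ?_ measurable_const
  · exact measurableSet_le ((hT i).comp measurable_snd) measurable_fst
  · exact (hc i).comp (f := fun x : ℝ≥0 × Ω => (x.1 - T i x.2, x.2))
      ((measurable_fst.sub ((hT i).comp measurable_snd)).prodMk measurable_snd)

end Measurability

/-! ### Freezing an independent variable -/

theorem lintegral_prodMk_of_indepFun {Ω α β : Type*} [MeasurableSpace Ω] [MeasurableSpace α]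
    [MeasurableSpace β] {P : Measure Ω} [IsProbabilityMeasure P] {Y : Ω → α} {Z : Ω → β}
    (hY : Measurable Y) (hZ : Measurable Z) (h : IndepFun Y Z P) {f : α × β → ℝ≥0∞}
    (hf : Measurable f) :
    ∫⁻ ω, f (Y ω, Z ω) ∂P = ∫⁻ a, ∫⁻ ω, f (a, Z ω) ∂P ∂(P.map Y) := by
  have : IsProbabilityMeasure (P.map Z) := Measure.isProbabilityMeasure_map hZ.aemeasurable
  rw [← lintegral_map hf (hY.prodMk hZ),
    (indepFun_iff_map_prod_eq_prod_map_map hY.aemeasurable hZ.aemeasurable).1 h,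
    lintegral_prod _ hf.aemeasurable]
  refine lintegral_congr fun a => ?_
  exact lintegral_map (f := fun y => f (a, y)) (hf.comp measurable_prodMk_left) hZ

/-- The second variable is the identity from `Ω` to `Ω` with the smaller sigma-algebra `m`. This
allows `Y` to be frozen inside a whole process, evaluated at a random time. -/
theorem lintegral_prodMk_of_indep {Ω α : Type*} [MeasurableSpace α] {m mΩ : MeasurableSpace Ω}
    (hm : m ≤ mΩ) {P : Measure Ω} [IsProbabilityMeasure P] {Y : Ω → α} (hY : Measurable Y)
    (h : Indep (MeasurableSpace.comap Y inferInstance) m P) {f : α × Ω → ℝ≥0∞}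
    (hf : Measurable[(inferInstance : MeasurableSpace α).prod m] f) :
    ∫⁻ ω, f (Y ω, ω) ∂P = ∫⁻ a, ∫⁻ ω, f (a, ω) ∂P ∂(P.map Y) := by
  have hind : @IndepFun Ω α Ω mΩ _ m Y id P := by
    refine (IndepFun_iff_Indep (mγ := m) Y id P).2 ?_
    rwa [MeasurableSpace.comap_id]
  exact @lintegral_prodMk_of_indepFun Ω α Ω mΩ _ m P _ Y id hY (measurable_id'' hm) hind f hf

theorem measurableSpace_prod_mono {Ω : Type*} {m m' : MeasurableSpace Ω} (h : m ≤ m') :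
    (inferInstance : MeasurableSpace ℝ≥0).prod m ≤ (inferInstance : MeasurableSpace ℝ≥0).prod m' :=
  sup_le_sup le_rfl (MeasurableSpace.comap_mono h)

/-! ### Sigma-algebras generated by groups of sources -/

namespace BatchNetwork

variable {Ω : Type*} {m : MeasurableSpace Ω} [MeasurableSpace Ω] {P : Measure Ω} {J : ℕ} {rate : ℝ}
  {p : PMF (Fin J → ℕ)} {q : Fin J → Fin J → ℝ≥0 → ℝ≥0∞}

theorem measurable_interarrival (N : BatchNetwork P J rate p q) (i : ℕ) :
    Measurable (interarrival N.T i) := by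
  cases i with
  | zero => exact (N.measurable_T 0).coe_nnreal_real
  | succ i => exact (N.measurable_T _).coe_nnreal_real.sub (N.measurable_T _).coe_nnreal_real

theorem measurable_location (N : BatchNetwork P J rate p q) (i j l t) :
    Measurable[_, ⊤] (N.X i j l t) := by
  refine @measurable_to_countable' _ _ ⊤ _ _ _ fun x => ?_
  have hs : ∀ k, MeasurableSet (N.X i j l t ⁻¹' {some k}) := fun k => N.measurable_X i j l t k
  cases x with
  | some k => exact hs k
  | none =>
    have : N.X i j l t ⁻¹' {none} = (⋃ k, N.X i j l t ⁻¹' {some k})ᶜ := by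
      ext ω
      simp [← Option.eq_none_iff_forall_some_ne, eq_comm]
    rw [this]
    exact (MeasurableSet.iUnion hs).compl

theorem sourceSigma_le (N : BatchNetwork P J rate p q) (r : RandomSource J) :
    sourceSigma N.T N.B N.X r ≤ ‹MeasurableSpace Ω› := by
  cases r with
  | gap i => exact (N.measurable_interarrival i).comap_le
  | batch i => exact (N.measurable_B i).comap_le
  | customer i j l => exact iSup_le fun t => (N.measurable_location i j l t).comap_le

/-- The sigma-algebra generated by the sources of randomness that belong to `S`. -/
@[reducible]
def sigmaOf (N : BatchNetwork P J rate p q) (S : Set (RandomSource J)) : MeasurableSpace Ω :=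
  ⨆ r ∈ S, sourceSigma N.T N.B N.X r

theorem sigmaOf_le (N : BatchNetwork P J rate p q) (S : Set (RandomSource J)) :
    N.sigmaOf S ≤ ‹MeasurableSpace Ω› :=
  iSup₂_le fun r _ => N.sourceSigma_le r

theorem sourceSigma_le_sigmaOf (N : BatchNetwork P J rate p q) {S : Set (RandomSource J)}
    {r : RandomSource J} (hr : r ∈ S) : sourceSigma N.T N.B N.X r ≤ N.sigmaOf S :=
  le_iSup₂ (f := fun r (_ : r ∈ S) => sourceSigma N.T N.B N.X r) r hr

theorem indep_sigmaOf (N : BatchNetwork P J rate p q) {S S' : Set (RandomSource J)}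
    (h : Disjoint S S') : Indep (N.sigmaOf S) (N.sigmaOf S') P :=
  indep_iSup_of_disjoint N.sourceSigma_le N.indep h

/-- The vector of the numbers of customers of batch `i` in the queues, at age `t`. -/
noncomputable def batchVec (N : BatchNetwork P J rate p q) (i : ℕ) (t : ℝ≥0) (ω : Ω) :
    Fin J → ℝ≥0∞ :=
  fun k => N.batchCount i k t ω

/-- The vector of queue lengths at time `t`. -/
noncomputable def occVec (N : BatchNetwork P J rate p q) (t : ℝ≥0) (ω : Ω) : Fin J → ℝ≥0∞ :=
  fun k => N.occupancy t k ω

/-- Measurability is proved for any `m` containing the relevant sources, since independence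
arguments need it for sub-sigma-algebras and not only for the ambient one. -/
theorem measurable_batchCount_of_le (N : BatchNetwork P J rate p q) (i : ℕ)
    (hB : sourceSigma N.T N.B N.X (.batch i) ≤ m)
    (hX : ∀ j l, sourceSigma N.T N.B N.X (.customer i j l) ≤ m) (k : Fin J) :
    Measurable[(inferInstance : MeasurableSpace ℝ≥0).prod m]
      fun x : ℝ≥0 × Ω => (N.batchCount i k x.1 x.2 : ℝ≥0∞) :=
  @measurable_batch_location Ω m J (N.B i) (N.X i) (measurable_iff_comap_le.2 hB)
    (fun j l k => measurableSpace_prod_mono (hX j l) _ (N.jointly_measurable_X i j l k)) k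

theorem measurable_batchVec_of_le (N : BatchNetwork P J rate p q) (i : ℕ)
    (hB : sourceSigma N.T N.B N.X (.batch i) ≤ m)
    (hX : ∀ j l, sourceSigma N.T N.B N.X (.customer i j l) ≤ m) :
    Measurable[(inferInstance : MeasurableSpace ℝ≥0).prod m]
      fun x : ℝ≥0 × Ω => N.batchVec i x.1 x.2 :=
  @measurable_pi_lambda _ _ _ (_) _ _ fun k => N.measurable_batchCount_of_le i hB hX k

theorem measurable_occVec_of_le (N : BatchNetwork P J rate p q)
    (hT : ∀ i, Measurable[m] (N.T i))
    (hB : ∀ i, sourceSigma N.T N.B N.X (.batch i) ≤ m)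
    (hX : ∀ i j l, sourceSigma N.T N.B N.X (.customer i j l) ≤ m) :
    Measurable[(inferInstance : MeasurableSpace ℝ≥0).prod m]
      fun x : ℝ≥0 × Ω => N.occVec x.1 x.2 :=
  @measurable_pi_lambda _ _ _ (_) _ _ fun k =>
    @measurable_tsum_delayed Ω m N.T (fun i t ω => N.batchCount i k t ω) hT
      fun i => N.measurable_batchCount_of_le i (hB i) (hX i) k

theorem measurable_batchVec (N : BatchNetwork P J rate p q) (i : ℕ) :
    Measurable fun x : ℝ≥0 × Ω => N.batchVec i x.1 x.2 :=
  N.measurable_batchVec_of_le i (N.sourceSigma_le _) fun _ _ => N.sourceSigma_le _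

theorem measurable_occVec (N : BatchNetwork P J rate p q) :
    Measurable fun x : ℝ≥0 × Ω => N.occVec x.1 x.2 :=
  N.measurable_occVec_of_le N.measurable_T (fun _ => N.sourceSigma_le _)
    fun _ _ _ => N.sourceSigma_le _

end BatchNetwork

/-! ### Decomposition at the first arrival and the renewal equation -/

theorem iIndep_mono {Ω ι : Type*} {m m' : ι → MeasurableSpace Ω} {mΩ : MeasurableSpace Ω}
    {P : Measure Ω} (h : iIndep m P) (hle : ∀ i, m' i ≤ m i) : iIndep m' P := by
  rw [iIndep_iff] at h ⊢
  exact fun s f hf => h s fun i hi => hle i _ (hf i hi)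

theorem ae_expMeasure_nonneg (rate : ℝ) : ∀ᵐ s ∂expMeasure rate, 0 ≤ s := by
  rw [ae_iff]
  simp only [not_le]
  change expMeasure rate (Set.Iio 0) = 0
  rw [expMeasure, gammaMeasure, withDensity_apply _ measurableSet_Iio]
  exact lintegral_gammaPDF_of_nonpos le_rfl

theorem expMeasure_Iic {rate : ℝ} (hrate : 0 < rate) (t : ℝ≥0) :
    expMeasure rate (Set.Iic (t : ℝ)) = ENNReal.ofReal (1 - Real.exp (-(rate * t))) := by
  rw [expMeasure, gammaMeasure, withDensity_apply _ measurableSet_Iic]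
  exact (lintegral_exponentialPDF_eq_antiDeriv hrate t).trans (by simp)

theorem measurable_ite_delayed {Ω : Type*} [MeasurableSpace Ω] {E : Type*} [AddZeroClass E]
    [MeasurableSpace E] [MeasurableAdd₂ E] {f g : ℝ≥0 → Ω → E}
    (hf : Measurable fun x : ℝ≥0 × Ω => f x.1 x.2) (hg : Measurable fun x : ℝ≥0 × Ω => g x.1 x.2)
    {A : Set E} (hA : MeasurableSet A) (t : ℝ≥0) :
    Measurable fun x : ℝ × Ω => if x.1 ≤ t then A.indicator (1 : E → ℝ≥0∞)
      (f (t - x.1.toNNReal) x.2 + g (t - x.1.toNNReal) x.2) else A.indicator 1 0 := by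
  have hsub : Measurable fun x : ℝ × Ω => (t - x.1.toNNReal, x.2) := by fun_prop
  exact Measurable.ite (measurable_fst measurableSet_Iic)
    ((measurable_one.indicator hA).comp ((hf.comp hsub).add (hg.comp hsub))) measurable_const

/-- The index of a source of randomness after the first batch has been skipped. -/
def RandomSource.succ {J : ℕ} : RandomSource J → RandomSource J
  | .gap i => .gap (i + 1)
  | .batch i => .batch (i + 1)
  | .customer i j l => .customer (i + 1) j l

theorem RandomSource.succ_injective {J : ℕ} :
    Function.Injective (RandomSource.succ : RandomSource J → RandomSource J) := by
  rintro (_ | _ | _) (_ | _ | _) h <;> simp_all [RandomSource.succ]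

namespace BatchNetwork

variable {Ω : Type*} {m : MeasurableSpace Ω} [MeasurableSpace Ω] {P : Measure Ω} {J : ℕ} {rate : ℝ}
  {p : PMF (Fin J → ℕ)} {q : Fin J → Fin J → ℝ≥0 → ℝ≥0∞}

theorem ae_interarrival_nonneg (N : BatchNetwork P J rate p q) :
    ∀ᵐ ω ∂P, ∀ i, 0 ≤ interarrival N.T i ω := by
  refine ae_all_iff.2 fun i => ?_
  have h := ae_expMeasure_nonneg rate
  rw [← N.law_gap i] at h
  exact ae_of_ae_map (N.measurable_interarrival i).aemeasurable h

/-- Arrival times counted from the arrival of the first batch, which is skipped. -/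
noncomputable def shiftT (N : BatchNetwork P J rate p q) (i : ℕ) (ω : Ω) : ℝ≥0 :=
  ∑ k ∈ Finset.range (i + 1), (interarrival N.T (k + 1) ω).toNNReal

/-- Gaps are non-negative only almost surely, while shifted arrival times must lie in `ℝ≥0`
everywhere; hence the truncation, which changes no law. -/
theorem interarrival_shiftT (N : BatchNetwork P J rate p q) (i : ℕ) (ω : Ω) :
    interarrival N.shiftT i ω = max (interarrival N.T (i + 1) ω) 0 := by
  cases i with
  | zero => simp [interarrival, shiftT]
  | succ i =>
    rw [interarrival, shiftT, Finset.sum_range_succ, shiftT, NNReal.coe_add, add_sub_cancel_left]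
    simp

theorem sourceSigma_shift_le (N : BatchNetwork P J rate p q) (r : RandomSource J) :
    sourceSigma N.shiftT (fun i => N.B (i + 1)) (fun i => N.X (i + 1)) r ≤
      sourceSigma N.T N.B N.X r.succ := by
  cases r with
  | gap i =>
    have h : interarrival N.shiftT i = (fun x => max x 0) ∘ interarrival N.T (i + 1) :=
      funext fun ω => N.interarrival_shiftT i ω
    change MeasurableSpace.comap _ _ ≤ _
    rw [h, ← MeasurableSpace.comap_comp]
    exact MeasurableSpace.comap_mono
      (measurable_id.max measurable_const : Measurable fun x : ℝ => max x 0).comap_le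
  | batch i => exact le_rfl
  | customer i j l => exact le_rfl

/-- The network that the batches after the first one form, counting time from the first arrival. -/
noncomputable def shift (N : BatchNetwork P J rate p q) : BatchNetwork P J rate p q where
  T := N.shiftT
  B i := N.B (i + 1)
  X i := N.X (i + 1)
  measurable_T i := Finset.measurable_sum _ fun k _ =>
    (N.measurable_interarrival (k + 1)).real_toNNReal
  measurable_B i := N.measurable_B (i + 1)
  measurable_X i := N.measurable_X (i + 1)
  jointly_measurable_X i := N.jointly_measurable_X (i + 1)
  law_gap i := by
    rw [← N.law_gap (i + 1)]
    refine Measure.map_congr ?_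
    filter_upwards [N.ae_interarrival_nonneg] with ω hω
    rw [N.interarrival_shiftT, max_eq_left (hω _)]
  law_batch i := N.law_batch (i + 1)
  law_location i := N.law_location (i + 1)
  indep := iIndep_mono (N.indep.precomp RandomSource.succ_injective) N.sourceSigma_shift_le

theorem ae_T_succ (N : BatchNetwork P J rate p q) :
    ∀ᵐ ω ∂P, ∀ i, N.T (i + 1) ω = N.T 0 ω + N.shift.T i ω := by
  filter_upwards [N.ae_interarrival_nonneg] with ω hω i
  have h : ∀ i, N.T (i + 1) ω = N.T i ω + (interarrival N.T (i + 1) ω).toNNReal := fun i => by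
    apply NNReal.coe_injective
    rw [NNReal.coe_add, Real.coe_toNNReal _ (hω _), interarrival]
    ring
  induction i with
  | zero => simp [h 0, shift, shiftT]
  | succ i ih =>
    rw [h, ih, add_assoc]
    simp [shift, shiftT, Finset.sum_range_succ _ (i + 1)]

theorem ae_occVec_eq (N : BatchNetwork P J rate p q) (t : ℝ≥0) :
    ∀ᵐ ω ∂P, N.occVec t ω = if N.T 0 ω ≤ t then
      N.batchVec 0 (t - N.T 0 ω) ω + N.shift.occVec (t - N.T 0 ω) ω else 0 := by
  filter_upwards [N.ae_T_succ] with ω hω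
  funext k
  rw [occVec, occupancy, tsum_eq_zero_add' ENNReal.summable]
  split_ifs with h
  · simp only [Pi.add_apply]
    congr 1
    refine tsum_congr fun i => ?_
    rw [hω i, ← tsub_tsub]
    exact if_congr (le_tsub_iff_left h).symm rfl rfl
  · have h' : ∀ i, ¬ N.T (i + 1) ω ≤ t := fun i hi => h (le_self_add.trans ((hω i).symm.le.trans hi))
    simp [h']

/-- The sources of randomness of the first batch, except for its arrival time. -/
def firstBatchSources (J : ℕ) : Set (RandomSource J) :=
  {r | r = .batch 0 ∨ ∃ j l, r = .customer 0 j l}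

theorem measurable_batchVec_zero (N : BatchNetwork P J rate p q) {S : Set (RandomSource J)}
    (hS : firstBatchSources J ⊆ S) :
    Measurable[(inferInstance : MeasurableSpace ℝ≥0).prod (N.sigmaOf S)]
      fun x : ℝ≥0 × Ω => N.batchVec 0 x.1 x.2 :=
  N.measurable_batchVec_of_le 0 (N.sourceSigma_le_sigmaOf (hS (Or.inl rfl)))
    fun j l => N.sourceSigma_le_sigmaOf (hS (Or.inr ⟨j, l, rfl⟩))

theorem measurable_shift_occVec (N : BatchNetwork P J rate p q) {S : Set (RandomSource J)}
    (hS : Set.range RandomSource.succ ⊆ S) :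
    Measurable[(inferInstance : MeasurableSpace ℝ≥0).prod (N.sigmaOf S)]
      fun x : ℝ≥0 × Ω => N.shift.occVec x.1 x.2 := by
  have h : ∀ r, sourceSigma N.shift.T N.shift.B N.shift.X r ≤ N.sigmaOf S := fun r =>
    (N.sourceSigma_shift_le r).trans (N.sourceSigma_le_sigmaOf (hS ⟨r, rfl⟩))
  refine N.shift.measurable_occVec_of_le (fun i => ?_) (fun _ => h _) (fun _ _ _ => h _)
  change Measurable[N.sigmaOf S] fun ω =>
    ∑ k ∈ Finset.range (i + 1), (interarrival N.T (k + 1) ω).toNNReal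
  refine @Finset.measurable_sum ℝ≥0 ℕ Ω _ _ _ (N.sigmaOf S) _ _ fun k _ => ?_
  refine @Measurable.real_toNNReal _ (N.sigmaOf S) _ (measurable_iff_comap_le.2 ?_)
  exact N.sourceSigma_le_sigmaOf (r := .gap (k + 1)) (hS ⟨.gap k, rfl⟩)

theorem indepFun_batchVec_shift_occVec (N : BatchNetwork P J rate p q) (u : ℝ≥0) :
    IndepFun (N.batchVec 0 u) (N.shift.occVec u) P := by
  have hd : Disjoint (firstBatchSources J) (Set.range RandomSource.succ) := by
    rw [Set.disjoint_left]
    rintro r (rfl | ⟨j, l, rfl⟩) ⟨(_ | _ | _), h⟩ <;> simp [RandomSource.succ] at h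
  rw [IndepFun_iff_Indep]
  refine indep_of_indep_of_le_left (indep_of_indep_of_le_right (N.indep_sigmaOf hd) ?_) ?_
  · exact ((N.measurable_shift_occVec subset_rfl).comp
      (@measurable_prodMk_left _ _ _ (N.sigmaOf _) u)).comap_le
  · exact ((N.measurable_batchVec_zero subset_rfl).comp
      (@measurable_prodMk_left _ _ _ (N.sigmaOf _) u)).comap_le

/-- The probability that the first batch at age `u`, together with an independent network at time
`u`, has a vector of counts in `A`. -/
noncomputable def stepProb (N : BatchNetwork P J rate p q) (A : Set (Fin J → ℝ≥0∞)) (u : ℝ≥0) :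
    ℝ≥0∞ :=
  P {ω | N.batchVec 0 u ω + N.shift.occVec u ω ∈ A}

/-- The probability that the vector of queue lengths at time `u` is in `A`. -/
noncomputable def occProb (N : BatchNetwork P J rate p q) (A : Set (Fin J → ℝ≥0∞)) (u : ℝ≥0) :
    ℝ≥0∞ :=
  P {ω | N.occVec u ω ∈ A}

theorem measurable_stepProb [SFinite P] (N : BatchNetwork P J rate p q) {A : Set (Fin J → ℝ≥0∞)}
    (hA : MeasurableSet A) : Measurable (N.stepProb A) :=
  measurable_measure_prodMk_left
    (((N.measurable_batchVec 0).add N.shift.measurable_occVec) hA)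

/-- The first gap is independent of all other sources, and those determine both the first batch as a
function of its age and the shifted network. So the gap can be frozen at `s` and integrated last; if
`s > t` the network is still empty. -/
theorem occProb_eq_lintegral [IsProbabilityMeasure P] (N : BatchNetwork P J rate p q)
    {A : Set (Fin J → ℝ≥0∞)} (hA : MeasurableSet A) (t : ℝ≥0) :
    N.occProb A t = ∫⁻ s, (if s ≤ t then N.stepProb A (t - s.toNNReal)
      else A.indicator 1 0) ∂expMeasure rate := by
  set S : Set (RandomSource J) := {.gap 0}ᶜ
  have hS1 : firstBatchSources J ⊆ S := by
    rintro r (rfl | ⟨j, l, rfl⟩) <;> simp [S]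
  have hS2 : Set.range RandomSource.succ ⊆ S := by
    rintro _ ⟨(_ | _ | _), rfl⟩ <;> simp [S, RandomSource.succ]
  have hind : Indep (MeasurableSpace.comap (interarrival N.T 0) inferInstance) (N.sigmaOf S) P :=
    indep_of_indep_of_le_left (N.indep_sigmaOf (disjoint_compl_right (a := ({.gap 0} : Set (RandomSource J)))))
      (N.sourceSigma_le_sigmaOf (S := {.gap 0}) (r := .gap 0) rfl)
  let g : ℝ × Ω → ℝ≥0∞ := fun x => if x.1 ≤ t then A.indicator 1
    (N.batchVec 0 (t - x.1.toNNReal) x.2 + N.shift.occVec (t - x.1.toNNReal) x.2)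
      else A.indicator 1 0
  have hg : Measurable[(inferInstance : MeasurableSpace ℝ).prod (N.sigmaOf S)] g :=
    @measurable_ite_delayed Ω (N.sigmaOf S) (Fin J → ℝ≥0∞) _ _ _ (N.batchVec 0)
      N.shift.occVec (N.measurable_batchVec_zero hS1) (N.measurable_shift_occVec hS2) A hA t
  have h1 := lintegral_prodMk_of_indep (N.sigmaOf_le S) (N.measurable_interarrival 0) hind hg
  rw [N.law_gap 0] at h1
  have h2 : N.occProb A t = ∫⁻ ω, g (interarrival N.T 0 ω, ω) ∂P := by
    have hm : MeasurableSet {ω | N.occVec t ω ∈ A} :=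
      (N.measurable_occVec.comp measurable_prodMk_left) hA
    rw [occProb, ← lintegral_indicator_one hm]
    refine lintegral_congr_ae ?_
    filter_upwards [N.ae_occVec_eq t] with ω hω
    simp only [g, interarrival, NNReal.coe_le_coe, Real.toNNReal_coe]
    change A.indicator 1 (N.occVec t ω) = _
    rw [hω]
    split_ifs <;> rfl
  rw [h2, h1]
  refine lintegral_congr fun s => ?_
  simp only [g]
  split_ifs
  · rw [stepProb, ← lintegral_indicator_one]
    · rfl
    · exact (((N.measurable_batchVec 0).add N.shift.measurable_occVec).comp
        measurable_prodMk_left) hA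
  · simp

end BatchNetwork

/-! ### The parameters determine the law of the queue lengths -/

theorem identDistrib_of_measure_preimage_some {Ω K : Type*} [MeasurableSpace Ω] {P : Measure Ω}
    [IsProbabilityMeasure P] [MeasurableSpace (Option K)] [Finite K]
    {Y Z : Ω → Option K} (hY : Measurable Y) (hZ : Measurable Z)
    (h : ∀ k, P (Y ⁻¹' {some k}) = P (Z ⁻¹' {some k})) (hs : ∀ x : Option K, MeasurableSet {x}) :
    IdentDistrib Y Z P P := by
  have : MeasurableSingletonClass (Option K) := ⟨hs⟩
  have key : ∀ W : Ω → Option K, Measurable W →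
      P (W ⁻¹' {none}) = 1 - P (⋃ k, W ⁻¹' {some k}) := by
    intro W hW
    have hu : W ⁻¹' {none} = (⋃ k, W ⁻¹' {some k})ᶜ := by
      ext ω
      simp [Option.eq_none_iff_forall_ne_some]
    rw [hu, prob_compl_eq_one_sub (MeasurableSet.iUnion fun k => hW (hs _))]
  have key' : ∀ W : Ω → Option K, Measurable W →
      P (⋃ k, W ⁻¹' {some k}) = ∑' k, P (W ⁻¹' {some k}) := by
    intro W hW
    refine measure_iUnion (fun k k' hk => ?_) fun k => hW (hs _)
    rw [Function.onFun, Set.disjoint_left]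
    intro ω h1 h2
    exact hk (Option.some_injective _ (h1.symm.trans h2))
  refine ⟨hY.aemeasurable, hZ.aemeasurable, Measure.ext_of_singleton fun x => ?_⟩
  rw [Measure.map_apply hY (hs x), Measure.map_apply hZ (hs x)]
  cases x with
  | some k => exact h k
  | none => rw [key Y hY, key Z hZ, key' Y hY, key' Z hZ, tsum_congr h]

namespace BatchNetwork

variable {Ω : Type*} {m : MeasurableSpace Ω} [MeasurableSpace Ω] {P : Measure Ω} {J : ℕ} {rate : ℝ}
  {p : PMF (Fin J → ℕ)} {q : Fin J → Fin J → ℝ≥0 → ℝ≥0∞}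

theorem measurable_batchVec_at (N : BatchNetwork P J rate p q) (i : ℕ) (u : ℝ≥0) :
    Measurable (N.batchVec i u) :=
  Measurable.of_uncurry_left (f := N.batchVec i) (N.measurable_batchVec i)

theorem measurable_occVec_at (N : BatchNetwork P J rate p q) (u : ℝ≥0) :
    Measurable (N.occVec u) :=
  Measurable.of_uncurry_left (f := N.occVec) N.measurable_occVec

/-- The batch vector is a fixed measurable function of the batch sizes and of all locations at age
`u`. These are independent with prescribed laws, so their joint law is the same in both networks. -/
theorem map_batchVec_eq [IsProbabilityMeasure P] (N N' : BatchNetwork P J rate p q) (u : ℝ≥0) :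
    P.map (N.batchVec 0 u) = P.map (N'.batchVec 0 u) := by
  let _ : MeasurableSpace (Option (Fin J)) := ⊤
  let L : BatchNetwork P J rate p q → Fin J × ℕ → Ω → Option (Fin J) :=
    fun N a ω => N.X 0 a.1 a.2 u ω
  have hsource : ∀ (N : BatchNetwork P J rate p q) a,
      MeasurableSpace.comap (L N a) ⊤ ≤ sourceSigma N.T N.B N.X (.customer 0 a.1 a.2) :=
    fun N a => le_iSup (fun s => MeasurableSpace.comap (N.X 0 a.1 a.2 s) ⊤) u
  have hL : ∀ (N : BatchNetwork P J rate p q) a, Measurable (L N a) :=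
    fun N a => N.measurable_location 0 a.1 a.2 u
  have hLind : ∀ N : BatchNetwork P J rate p q, iIndepFun (L N) P := by
    intro N
    rw [iIndepFun_iff_iIndep]
    have hinj : Function.Injective
        fun a : Fin J × ℕ => (.customer 0 a.1 a.2 : RandomSource J) := by
      rintro ⟨j, l⟩ ⟨j', l'⟩ h
      simpa using h
    exact iIndep_mono (N.indep.precomp hinj) (hsource N)
  have hBL : ∀ N : BatchNetwork P J rate p q, IndepFun (N.B 0) (fun ω => (L N · ω)) P := by
    intro N
    rw [IndepFun_iff_Indep]
    have hd : Disjoint ({.batch 0} : Set (RandomSource J)) {r | ∃ j l, r = .customer 0 j l} := by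
      rw [Set.disjoint_left]
      rintro _ rfl ⟨j, l, h⟩
      cases h
    refine indep_of_indep_of_le_left (indep_of_indep_of_le_right (N.indep_sigmaOf hd) ?_) ?_
    · rw [MeasurableSpace.pi, MeasurableSpace.comap_iSup]
      refine iSup_le fun a => ?_
      rw [MeasurableSpace.comap_comp]
      exact (hsource N a).trans (N.sourceSigma_le_sigmaOf ⟨_, _, rfl⟩)
    · have h : sourceSigma N.T N.B N.X (.batch 0) ≤ N.sigmaOf {.batch 0} :=
        N.sourceSigma_le_sigmaOf (Set.mem_singleton _)
      exact h
  have hBid : IdentDistrib (N.B 0) (N'.B 0) P P := by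
    refine ⟨(N.measurable_B 0).aemeasurable, (N'.measurable_B 0).aemeasurable,
      Measure.ext_of_singleton fun n => ?_⟩
    rw [Measure.map_apply (N.measurable_B 0) (measurableSet_singleton n),
      Measure.map_apply (N'.measurable_B 0) (measurableSet_singleton n)]
    exact (N.law_batch 0 n).trans (N'.law_batch 0 n).symm
  have hLid : IdentDistrib (fun ω => (L N · ω)) (fun ω => (L N' · ω)) P P :=
    IdentDistrib.pi (fun a => identDistrib_of_measure_preimage_some (hL N a) (hL N' a)
      (fun k => (N.law_location 0 a.1 a.2 u k).trans (N'.law_location 0 a.1 a.2 u k).symm)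
      fun _ => MeasurableSpace.measurableSet_top) (hLind N) (hLind N')
  have hpair := hBid.prodMk hLid (hBL N) (hBL N')
  let F : (Fin J → ℕ) × (Fin J × ℕ → Option (Fin J)) → Fin J → ℝ≥0∞ := fun x k =>
    ((∑ j : Fin J, ∑ l ∈ Finset.range (x.1 j), if x.2 (j, l) = some k then 1 else 0 : ℕ) : ℝ≥0∞)
  have hF : Measurable F := by
    refine measurable_pi_lambda _ fun k => ?_
    -- A dummy time variable makes the joint measurability lemma applicable to `F`.
    refine Measurable.of_uncurry_left (m := NNReal.measurableSpace) (f := fun (_ : ℝ≥0) x => F x k) (x := 0) ?_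
    refine measurable_batch_location (Ω := (Fin J → ℕ) × (Fin J × ℕ → Option (Fin J)))
      (B := Prod.fst) (X := fun j l _ x => x.2 (j, l)) measurable_fst (fun j l k => ?_) k
    have hc : Measurable fun x : ℝ≥0 × (Fin J → ℕ) × (Fin J × ℕ → Option (Fin J)) =>
        x.2.2 (j, l) := (measurable_pi_apply _).comp (measurable_snd.comp measurable_snd)
    exact hc (MeasurableSpace.measurableSet_top (s := {some k}))
  exact (hpair.comp hF).map_eq

theorem stepProb_eq_lintegral [IsProbabilityMeasure P] (N : BatchNetwork P J rate p q)
    {A : Set (Fin J → ℝ≥0∞)} (hA : MeasurableSet A) (u : ℝ≥0) :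
    N.stepProb A u =
      ∫⁻ a, N.shift.occProb ((fun b => a + b) ⁻¹' A) u ∂P.map (N.batchVec 0 u) := by
  have hf : Measurable fun x : (Fin J → ℝ≥0∞) × (Fin J → ℝ≥0∞) =>
      A.indicator (1 : (Fin J → ℝ≥0∞) → ℝ≥0∞) (x.1 + x.2) :=
    (measurable_one.indicator hA).comp (measurable_fst.add measurable_snd)
  have h := lintegral_prodMk_of_indepFun (N.measurable_batchVec_at 0 u)
    (N.shift.measurable_occVec_at u) (N.indepFun_batchVec_shift_occVec u) hf
  have hm : MeasurableSet {ω | N.batchVec 0 u ω + N.shift.occVec u ω ∈ A} :=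
    ((N.measurable_batchVec_at 0 u).add (N.shift.measurable_occVec_at u)) hA
  rw [stepProb, ← lintegral_indicator_one hm]
  refine h.trans (lintegral_congr fun a => ?_)
  have hm' : MeasurableSet {ω | N.shift.occVec u ω ∈ (fun b => a + b) ⁻¹' A} :=
    ((N.shift.measurable_occVec_at u).const_add a) hA
  rw [occProb, ← lintegral_indicator_one hm']
  rfl

/-- Each use of the renewal equation pays a factor for an arrival before `t`, so after `n` uses the
networks differ by at most the `n`-th power of that probability. Conditioning on the first batch
translates `A` and replaces both networks by their shifts, so the induction runs over all of these.
-/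
theorem occProb_le_add_pow [IsProbabilityMeasure P] (t : ℝ≥0) (n : ℕ)
    (N N' : BatchNetwork P J rate p q) {A : Set (Fin J → ℝ≥0∞)} (hA : MeasurableSet A) {u : ℝ≥0}
    (hu : u ≤ t) :
    N.occProb A u ≤ N'.occProb A u + expMeasure rate (Set.Iic (t : ℝ)) ^ n := by
  induction n generalizing N N' A u with
  | zero =>
    rw [pow_zero]
    exact prob_le_one.trans le_add_self
  | succ n ih =>
    set r := expMeasure rate (Set.Iic (t : ℝ))
    have hstep : ∀ v ≤ t, N.stepProb A v ≤ N'.stepProb A v + r ^ n := by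
      intro v hv
      have : IsProbabilityMeasure (P.map (N'.batchVec 0 v)) :=
        Measure.isProbabilityMeasure_map (N'.measurable_batchVec_at 0 v).aemeasurable
      rw [N.stepProb_eq_lintegral hA, N'.stepProb_eq_lintegral hA, N.map_batchVec_eq N' v]
      calc _ ≤ ∫⁻ a, (N'.shift.occProb ((fun b => a + b) ⁻¹' A) v + r ^ n)
            ∂P.map (N'.batchVec 0 v) :=
            lintegral_mono fun a => ih N.shift N'.shift (measurable_const_add a hA) hv
        _ = _ := by rw [lintegral_add_right _ measurable_const]; simp
    rw [N.occProb_eq_lintegral hA, N'.occProb_eq_lintegral hA]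
    calc _ ≤ ∫⁻ s, ((if s ≤ u then N'.stepProb A (u - s.toNNReal) else A.indicator 1 0) +
          (Set.Iic (u : ℝ)).indicator (fun _ => r ^ n) s) ∂expMeasure rate := by
          refine lintegral_mono fun s => ?_
          by_cases hs : s ≤ u
          · simpa [hs] using hstep _ (tsub_le_self.trans hu)
          · simp [hs]
      _ = _ + r ^ n * expMeasure rate (Set.Iic (u : ℝ)) := by
          rw [lintegral_add_right _ (measurable_const.indicator measurableSet_Iic),
            lintegral_indicator measurableSet_Iic, setLIntegral_const]
      _ ≤ _ := by
          rw [pow_succ]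
          gcongr
          exact measure_mono (Set.Iic_subset_Iic.2 (NNReal.coe_le_coe.2 hu))

/-- The law of the queue lengths depends on the parameters of the network only. -/
theorem occProb_eq [IsProbabilityMeasure P] (hrate : 0 < rate)
    (N N' : BatchNetwork P J rate p q) {A : Set (Fin J → ℝ≥0∞)} (hA : MeasurableSet A) (t : ℝ≥0) :
    N.occProb A t = N'.occProb A t := by
  have hr : expMeasure rate (Set.Iic (t : ℝ)) < 1 := by
    rw [expMeasure_Iic hrate, ENNReal.ofReal_lt_one]
    linarith [Real.exp_pos (-(rate * t))]
  have key : ∀ N N' : BatchNetwork P J rate p q, N.occProb A t ≤ N'.occProb A t := by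
    intro N N'
    have hlim := (ENNReal.tendsto_pow_atTop_nhds_zero_of_lt_one hr).const_add (N'.occProb A t)
    rw [add_zero] at hlim
    exact ge_of_tendsto' hlim fun n => occProb_le_add_pow t n N N' hA le_rfl
  exact le_antisymm (key N N') (key N' N)

/-- Once the first batch has left, only the shifted network counts, and it has the law of the
original one. -/
theorem stepProb_le [IsProbabilityMeasure P] (hrate : 0 < rate) (N : BatchNetwork P J rate p q)
    {A : Set (Fin J → ℝ≥0∞)} (hA : MeasurableSet A) (u : ℝ≥0) :
    N.stepProb A u ≤ N.occProb A u + P {ω | N.batchVec 0 u ω ≠ 0} := by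
  rw [occProb_eq hrate N N.shift hA]
  refine (measure_mono fun ω hω => ?_).trans (measure_union_le _ _)
  by_cases h : N.batchVec 0 u ω = 0
  · left
    simpa [h] using hω
  · exact Or.inr h

theorem occProb_le_stepProb [IsProbabilityMeasure P] (hrate : 0 < rate)
    (N : BatchNetwork P J rate p q) {A : Set (Fin J → ℝ≥0∞)} (hA : MeasurableSet A) (u : ℝ≥0) :
    N.occProb A u ≤ N.stepProb A u + P {ω | N.batchVec 0 u ω ≠ 0} := by
  rw [occProb_eq hrate N N.shift hA]
  refine (measure_mono fun ω hω => ?_).trans (measure_union_le _ _)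
  by_cases h : N.batchVec 0 u ω = 0
  · left
    simpa [h] using hω
  · exact Or.inr h

end BatchNetwork

/-! ### Mean batch content and mean occupation time -/

theorem measurable_indicator_one {Ω : Type*} [MeasurableSpace Ω] {s : Set Ω}
    (hs : MeasurableSet s) : Measurable (s.indicator (1 : Ω → ℝ≥0∞)) :=
  measurable_one.indicator hs

theorem measurable_toNNReal_prodMk {Ω : Type*} [MeasurableSpace Ω] :
    Measurable fun x : ℝ × Ω => (x.1.toNNReal, x.2) := by
  fun_prop

namespace BatchNetwork

variable {Ω : Type*} {m : MeasurableSpace Ω} [MeasurableSpace Ω] {P : Measure Ω} {J : ℕ} {rate : ℝ}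
  {p : PMF (Fin J → ℕ)} {q : Fin J → Fin J → ℝ≥0 → ℝ≥0∞}

/-- Measurability of `q` is inherited from the joint measurability of any single route. -/
theorem measurable_q [SFinite P] (N : BatchNetwork P J rate p q) (j k : Fin J) :
    Measurable (q j k) := by
  have h : q j k = fun t => P (Prod.mk t ⁻¹' {x : ℝ≥0 × Ω | N.X 0 j 0 x.1 x.2 = some k}) :=
    funext fun t => (N.law_location 0 j 0 t k).symm
  rw [h]
  exact measurable_measure_prodMk_left
    (measurableSpace_prod_mono (N.sourceSigma_le _) _ (N.jointly_measurable_X 0 j 0 k))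

theorem measurable_B_apply (N : BatchNetwork P J rate p q) (i : ℕ) (j : Fin J) :
    Measurable[sourceSigma N.T N.B N.X (.batch i)] fun ω => N.B i ω j :=
  (measurable_pi_apply j).comp (comap_measurable (N.B i))

theorem measurableSet_lt_B (N : BatchNetwork P J rate p q) (i : ℕ) (j : Fin J) (l : ℕ) :
    MeasurableSet[sourceSigma N.T N.B N.X (.batch i)] {ω | l < N.B i ω j} :=
  N.measurable_B_apply i j (measurableSet_Ioi (a := l))

/-- Tail-sum formula for the mean. Summing over all potential customers `l`, with the event `l < B`
as a weight, avoids sums of random length. -/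
theorem tsum_measure_lt_B (N : BatchNetwork P J rate p q) (i : ℕ) (j : Fin J) :
    ∑' l, P {ω | l < N.B i ω j} = meanBatch p j := by
  have hm : ∀ l, MeasurableSet {ω | l < N.B i ω j} := fun l =>
    N.sourceSigma_le _ _ (N.measurableSet_lt_B i j l)
  have h1 : ∫⁻ ω, (N.B i ω j : ℝ≥0∞) ∂P = meanBatch p j := by
    rw [← lintegral_map (f := fun n : Fin J → ℕ => (n j : ℝ≥0∞))
      (Measurable.of_discrete) (N.measurable_B i), lintegral_countable']
    refine tsum_congr fun n => ?_
    rw [Measure.map_apply (N.measurable_B i) (measurableSet_singleton n), mul_comm]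
    exact congrArg (· * _) (N.law_batch i n)
  rw [← h1]
  calc _ = ∑' l, ∫⁻ ω, {ω | l < N.B i ω j}.indicator 1 ω ∂P :=
        tsum_congr fun l => (lintegral_indicator_one (hm l)).symm
    _ = ∫⁻ ω, ∑' l, {ω | l < N.B i ω j}.indicator 1 ω ∂P :=
        (lintegral_tsum fun l => (measurable_one.indicator (hm l)).aemeasurable).symm
    _ = _ := by
        refine lintegral_congr fun ω => ?_
        have := natCast_sum_range_eq_tsum (N.B i ω j) fun _ => 1
        simp only [Finset.sum_const, Finset.card_range, smul_eq_mul, mul_one, Nat.cast_one] at this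
        rw [this]
        simp [Set.indicator_apply]

theorem lintegral_indicator_lt_B_mul (N : BatchNetwork P J rate p q) (i : ℕ) (j : Fin J) (l : ℕ)
    {f : Ω → ℝ≥0∞} (hf : Measurable[sourceSigma N.T N.B N.X (.customer i j l)] f) :
    ∫⁻ ω, {ω | l < N.B i ω j}.indicator 1 ω * f ω ∂P = P {ω | l < N.B i ω j} * ∫⁻ ω, f ω ∂P := by
  have hne : (.batch i : RandomSource J) ≠ .customer i j l := by simp
  rw [lintegral_mul_eq_lintegral_mul_lintegral_of_independent_measurableSpace
    (N.sourceSigma_le _) (N.sourceSigma_le _) (N.indep.indep hne)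
    (@measurable_indicator_one _ (_) _ (N.measurableSet_lt_B i j l)) hf,
    lintegral_indicator_one (N.sourceSigma_le _ _ (N.measurableSet_lt_B i j l))]

theorem lintegral_batchVec (N : BatchNetwork P J rate p q) (i : ℕ) (u : ℝ≥0) (k : Fin J) :
    ∫⁻ ω, N.batchVec i u ω k ∂P = ∑ j, meanBatch p j * q j k u := by
  have hX : ∀ j l, MeasurableSet[sourceSigma N.T N.B N.X (.customer i j l)]
      {ω | N.X i j l u ω = some k} := fun j l =>
    le_iSup (fun s => MeasurableSpace.comap (N.X i j l s) ⊤) u _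
      ⟨{some k}, MeasurableSpace.measurableSet_top, rfl⟩
  have hf : ∀ j l, Measurable[sourceSigma N.T N.B N.X (.customer i j l)]
      ({ω | N.X i j l u ω = some k}.indicator (1 : Ω → ℝ≥0∞)) := fun j l =>
    @measurable_indicator_one _ (_) _ (hX j l)
  have h : ∀ ω, N.batchVec i u ω k = ∑ j, ∑' l, {ω | l < N.B i ω j}.indicator 1 ω *
      {ω | N.X i j l u ω = some k}.indicator 1 ω := by
    intro ω
    rw [batchVec, batchCount, Nat.cast_sum]
    refine Finset.sum_congr rfl fun j _ => ?_
    rw [natCast_sum_range_eq_tsum]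
    refine tsum_congr fun l => ?_
    by_cases hl : l < N.B i ω j <;> simp [hl, Set.indicator_apply]
  have hm : ∀ j l, Measurable fun ω => {ω | l < N.B i ω j}.indicator (1 : Ω → ℝ≥0∞) ω *
      {ω | N.X i j l u ω = some k}.indicator 1 ω := fun j l =>
    (measurable_one.indicator (N.sourceSigma_le _ _ (N.measurableSet_lt_B i j l))).mul
      ((hf j l).mono (N.sourceSigma_le _) le_rfl)
  simp_rw [h]
  rw [lintegral_finsetSum _ fun j _ => Measurable.tsum fun l => hm j l]
  refine Finset.sum_congr rfl fun j _ => ?_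
  rw [lintegral_tsum fun l => (hm j l).aemeasurable, ← N.tsum_measure_lt_B i j,
    ← ENNReal.tsum_mul_right]
  refine tsum_congr fun l => ?_
  rw [N.lintegral_indicator_lt_B_mul i j l (hf j l),
    lintegral_indicator_one (N.measurable_X i j l u k), N.law_location]

/-- Markov's inequality: counts are integers, so a non-zero vector has total at least one. -/
theorem measure_batchVec_ne_zero_le (N : BatchNetwork P J rate p q) (i : ℕ) (u : ℝ≥0) :
    P {ω | N.batchVec i u ω ≠ 0} ≤ ∑ j, meanBatch p j * networkTail q j u := by
  have hm := N.measurable_batchVec_at i u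
  calc P {ω | N.batchVec i u ω ≠ 0}
      = ∫⁻ ω, {ω | N.batchVec i u ω ≠ 0}.indicator 1 ω ∂P :=
        (lintegral_indicator_one (hm (measurableSet_singleton 0).compl)).symm
    _ ≤ ∫⁻ ω, ∑ k, N.batchVec i u ω k ∂P := by
        refine lintegral_mono fun ω => ?_
        by_cases h : N.batchVec i u ω = 0
        · simp [h]
        · obtain ⟨k, hk⟩ := Function.ne_iff.1 h
          rw [Set.indicator_of_mem h]
          refine le_trans ?_ (Finset.single_le_sum (f := fun k => N.batchVec i u ω k)
            (fun _ _ => zero_le) (Finset.mem_univ k))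
          simp only [batchVec, Pi.zero_apply, ne_eq, Nat.cast_eq_zero] at hk
          simp only [Pi.one_apply, batchVec]
          exact_mod_cast Nat.one_le_iff_ne_zero.2 hk
    _ = ∑ j, meanBatch p j * networkTail q j u := by
        have hk : ∀ k, Measurable fun ω => N.batchVec i u ω k := measurable_pi_iff.1 hm
        rw [lintegral_finsetSum _ fun k _ => hk k]
        simp_rw [N.lintegral_batchVec, networkTail, Finset.mul_sum]
        exact Finset.sum_comm

/-- The total time that a customer spends in queue `k`. -/
noncomputable def customerTime (N : BatchNetwork P J rate p q) (i : ℕ) (j : Fin J) (l : ℕ)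
    (k : Fin J) (ω : Ω) : ℝ≥0∞ :=
  volume.restrict (Set.Ioi (0 : ℝ)) {t : ℝ | N.X i j l t.toNNReal ω = some k}

theorem measurableSet_location_real (N : BatchNetwork P J rate p q) (i : ℕ) (j : Fin J) (l : ℕ)
    (k : Fin J) :
    MeasurableSet[(inferInstance : MeasurableSpace ℝ).prod
      (sourceSigma N.T N.B N.X (.customer i j l))]
      {x : ℝ × Ω | N.X i j l x.1.toNNReal x.2 = some k} := by
  have h := N.jointly_measurable_X i j l k
  have hs : Measurable[(inferInstance : MeasurableSpace ℝ).prod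
        (sourceSigma N.T N.B N.X (.customer i j l)), (inferInstance : MeasurableSpace ℝ≥0).prod
        (sourceSigma N.T N.B N.X (.customer i j l))]
      fun x : ℝ × Ω => (x.1.toNNReal, x.2) :=
    @measurable_toNNReal_prodMk Ω (_)
  exact hs h

theorem measurable_customerTime (N : BatchNetwork P J rate p q) (i : ℕ) (j : Fin J) (l : ℕ)
    (k : Fin J) :
    Measurable[sourceSigma N.T N.B N.X (.customer i j l)] (N.customerTime i j l k) :=
  @measurable_measure_prodMk_right _ _ _ (_) _ _ _ (N.measurableSet_location_real i j l k)

theorem lintegral_customerTime [SFinite P] (N : BatchNetwork P J rate p q) (i : ℕ) (j : Fin J)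
    (l : ℕ) (k : Fin J) :
    ∫⁻ ω, N.customerTime i j l k ω ∂P = ∫⁻ t in Set.Ioi (0 : ℝ), q j k t.toNNReal := by
  have hs : MeasurableSet {x : ℝ × Ω | N.X i j l x.1.toNNReal x.2 = some k} :=
    sup_le_sup le_rfl (MeasurableSpace.comap_mono (N.sourceSigma_le (.customer i j l))) _
      (N.measurableSet_location_real i j l k)
  have h1 := Measure.prod_apply_symm (μ := volume.restrict (Set.Ioi (0 : ℝ))) (ν := P) hs
  have h2 := Measure.prod_apply (μ := volume.restrict (Set.Ioi (0 : ℝ))) (ν := P) hs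
  refine h1.symm.trans (h2.trans (lintegral_congr fun t => ?_))
  exact N.law_location i j l t.toNNReal k

theorem lintegral_batchOccupancyTime_le [SFinite P] (N : BatchNetwork P J rate p q) (i : ℕ) :
    ∫⁻ ω, N.batchOccupancyTime i ω ∂P ≤ ∑ j, meanBatch p j * meanNetworkTime q j := by
  have hm : ∀ j l k, Measurable fun ω => {ω | l < N.B i ω j}.indicator (1 : Ω → ℝ≥0∞) ω *
      N.customerTime i j l k ω := fun j l k =>
    (measurable_one.indicator (N.sourceSigma_le _ _ (N.measurableSet_lt_B i j l))).mul
      ((N.measurable_customerTime i j l k).mono (N.sourceSigma_le _) le_rfl)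
  have hle : ∀ ω, N.batchOccupancyTime i ω ≤ ∑ j, ∑' l, ∑ k,
      {ω | l < N.B i ω j}.indicator 1 ω * N.customerTime i j l k ω := by
    intro ω
    have hsub : N.batchOccupancyTime i ω ≤ volume.restrict (Set.Ioi (0 : ℝ))
        (⋃ j, ⋃ l, ⋃ k, {t : ℝ | l < N.B i ω j ∧ N.X i j l t.toNNReal ω = some k}) := by
      -- Occupation time includes `t = 0`, whereas the mean integrates over `t > 0`; the extra point
      -- is null.
      rw [Measure.restrict_congr_set Ioi_ae_eq_Ici, Measure.restrict_apply' measurableSet_Ici]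
      refine measure_mono ?_
      rintro t ⟨ht, j, k, l, hl, hk⟩
      refine ⟨?_, ht⟩
      simp only [Set.mem_iUnion]
      exact ⟨j, l, k, hl, hk⟩
    refine hsub.trans ((measure_iUnion_fintype_le _ _).trans (Finset.sum_le_sum fun j _ =>
      (measure_iUnion_le _).trans (ENNReal.tsum_le_tsum fun l =>
        (measure_iUnion_fintype_le _ _).trans (Finset.sum_le_sum fun k _ => ?_))))
    by_cases h : l < N.B i ω j <;> simp [h, customerTime]
  calc _ ≤ ∫⁻ ω, ∑ j, ∑' l, ∑ k,
        {ω | l < N.B i ω j}.indicator 1 ω * N.customerTime i j l k ω ∂P := lintegral_mono hle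
    _ = ∑ j, ∑' l, ∑ k, P {ω | l < N.B i ω j} * ∫⁻ t in Set.Ioi (0 : ℝ), q j k t.toNNReal := by
        rw [lintegral_finsetSum _ fun j _ => Measurable.tsum fun l =>
          Finset.measurable_sum _ fun k _ => hm j l k]
        refine Finset.sum_congr rfl fun j _ => ?_
        rw [lintegral_tsum fun l => (Finset.measurable_sum _ fun k _ => hm j l k).aemeasurable]
        refine tsum_congr fun l => ?_
        rw [lintegral_finsetSum _ fun k _ => hm j l k]
        refine Finset.sum_congr rfl fun k _ => ?_
        rw [N.lintegral_indicator_lt_B_mul i j l (N.measurable_customerTime i j l k),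
          N.lintegral_customerTime]
    _ = _ := by
        refine Finset.sum_congr rfl fun j _ => ?_
        simp_rw [← Finset.mul_sum]
        rw [ENNReal.tsum_mul_right, N.tsum_measure_lt_B, meanNetworkTime]
        simp_rw [networkTail]
        have hk : ∀ k, Measurable fun t : ℝ => q j k t.toNNReal := fun k =>
          (N.measurable_q j k).comp measurable_real_toNNReal
        rw [lintegral_finsetSum _ fun k _ => hk k]

end BatchNetwork

/-! ### From the renewal equation to convergence -/

/-- A bounded solution `f` of a renewal equation with exponential gaps changes at most as much as
the integral of a bound on the distance between `f` and the integrand `h`. -/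
theorem abs_sub_le_of_renewal {c a : ℝ} {h f e : ℝ → ℝ} (hc : 0 < c) (hh : Measurable h)
    (hb : ∀ u, |h u| ≤ 1)
    (hf : ∀ t, 0 ≤ t → f t = Real.exp (-(c * t)) *
      (a + ∫ u in (0 : ℝ)..t, c * Real.exp (c * u) * h u))
    (hle : ∀ u, 0 ≤ u → |h u - f u| ≤ e u) {s t : ℝ} (hs : 0 ≤ s) (hst : s ≤ t)
    (he : IntervalIntegrable e volume s t) :
    |f t - f s| ≤ c * ∫ u in s..t, e u := by
  set k : ℝ → ℝ := fun u => c * Real.exp (c * u) * h u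
  set g : ℝ → ℝ := fun x => Real.exp (-(c * x)) * (a + ∫ u in (0 : ℝ)..x, k u)
  have ht : 0 ≤ t := hs.trans hst
  have hk : IntervalIntegrable k volume 0 t := by
    have h1 : IntervalIntegrable (fun u => c * Real.exp (c * u)) volume 0 t :=
      Continuous.intervalIntegrable (by fun_prop) _ _
    refine IntervalIntegrable.mono_fun h1 (by fun_prop) (Eventually.of_forall fun u => ?_)
    simp only [k, norm_mul]
    exact mul_le_of_le_one_right (by positivity) (hb u)
  have hsub : Set.uIcc s t ⊆ Set.uIcc 0 t := by
    rw [Set.uIcc_of_le hst, Set.uIcc_of_le ht]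
    exact Set.Icc_subset_Icc_left hs
  have hconst : AbsolutelyContinuousOnInterval (fun _ : ℝ => a) 0 t :=
    contDiffOn_const.absolutelyContinuousOnInterval
  have hexp : AbsolutelyContinuousOnInterval (fun x : ℝ => Real.exp (-(c * x))) 0 t :=
    ContDiffOn.absolutelyContinuousOnInterval (ContDiff.contDiffOn (by fun_prop))
  -- Since `h` is only measurable, `g` need not be differentiable everywhere. Absolute continuity
  -- lets its increment be recovered from the almost everywhere derivative `c * (h - g)`.
  have hg : AbsolutelyContinuousOnInterval g s t :=
    (hexp.fun_mul (hconst.fun_add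
      (hk.absolutelyContinuousOnInterval_intervalIntegral (c := 0) (by simp)))).mono hsub
  have hderiv : ∀ᵐ x, x ∈ Set.uIcc s t → deriv g x = c * (h x - g x) := by
    filter_upwards [hk.ae_hasDerivAt_integral] with x hx hxm
    have h1 := hx (hsub hxm) 0 (by simp)
    have h2 : HasDerivAt (fun x : ℝ => Real.exp (-(c * x))) (Real.exp (-(c * x)) * (-(c * 1))) x :=
      (((hasDerivAt_id x).const_mul c).neg).exp
    have h4 : deriv g x = _ := (h2.mul (h1.const_add a)).deriv
    rw [h4]
    have h3 : Real.exp (-(c * x)) * Real.exp (c * x) = 1 := by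
      rw [← Real.exp_add]; simp
    simp only [g, k]
    linear_combination (c * h x) * h3
  rw [hf t ht, hf s hs]
  change |g t - g s| ≤ _
  rw [← hg.integral_deriv_eq_sub, ← intervalIntegral.integral_const_mul, ← Real.norm_eq_abs]
  refine intervalIntegral.norm_integral_le_of_norm_le hst ?_ (he.const_mul c)
  filter_upwards [hderiv] with x hx hxm
  have hx0 : 0 ≤ x := hs.trans hxm.1.le
  rw [hx (Set.uIoc_subset_uIcc (by rwa [Set.uIoc_of_le hst])), norm_mul, Real.norm_eq_abs,
    abs_of_pos hc, Real.norm_eq_abs]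
  have := hle x hx0
  rw [hf x hx0] at this
  gcongr

/-- Substitute `u = t - s` and factor `exp (-(c * s))` as `exp (-(c * t)) * exp (c * u)`. Then `t`
enters only through a prefactor and the upper limit, which makes differentiation in `t` possible. -/
theorem toReal_lintegral_expMeasure_ite {c : ℝ} (hc : 0 < c) {H : ℝ≥0 → ℝ≥0∞} (hH : Measurable H)
    (hH1 : ∀ u, H u ≤ 1) {b : ℝ≥0∞} (hb : b ≤ 1) {t : ℝ} (ht : 0 ≤ t) :
    (∫⁻ s, (if s ≤ t then H (t.toNNReal - s.toNNReal) else b) ∂expMeasure c).toReal =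
      Real.exp (-(c * t)) *
        (b.toReal + ∫ u in (0 : ℝ)..t, c * Real.exp (c * u) * (H u.toNNReal).toReal) := by
  have := isProbabilityMeasure_expMeasure hc
  set φ : ℝ → ℝ≥0∞ := fun s => if s ≤ t then H (t.toNNReal - s.toNNReal) else b
  have hφm : Measurable φ :=
    Measurable.ite measurableSet_Iic (hH.comp (by fun_prop)) measurable_const
  have hφ1 : ∀ s, φ s ≤ 1 := fun s => by
    simp only [φ]; split_ifs; exacts [hH1 _, hb]
  have hφt : ∀ s, (φ s).toReal ≤ 1 := fun s =>
    ENNReal.toReal_mono ENNReal.one_ne_top (hφ1 s)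
  have hint : Integrable (fun s => (φ s).toReal) (expMeasure c) :=
    Integrable.of_bound hφm.ennreal_toReal.aestronglyMeasurable 1
      (Eventually.of_forall fun s => by
        rw [Real.norm_of_nonneg ENNReal.toReal_nonneg]; exact hφt s)
  rw [← integral_toReal hφm.aemeasurable
    (Eventually.of_forall fun s => (hφ1 s).trans_lt ENNReal.one_lt_top),
    ← integral_add_compl (measurableSet_Iic (a := t)) hint]
  have h2 : ∫ s in (Set.Iic t)ᶜ, (φ s).toReal ∂expMeasure c = Real.exp (-(c * t)) * b.toReal := by
    rw [setIntegral_congr_fun (g := fun _ => b.toReal) measurableSet_Iic.compl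
      (fun s hs => by simp only [φ]; rw [if_neg (by simpa using hs)]), setIntegral_const,
      measureReal_def, prob_compl_eq_one_sub measurableSet_Iic, smul_eq_mul]
    have h3 := expMeasure_Iic hc t.toNNReal
    rw [Real.coe_toNNReal _ ht] at h3
    have h4 : Real.exp (-(c * t)) ≤ 1 := Real.exp_le_one_iff.2 (by nlinarith)
    rw [h3, ← ENNReal.ofReal_one, ← ENNReal.ofReal_sub _ (by linarith), sub_sub_cancel,
      ENNReal.toReal_ofReal (Real.exp_pos _).le]
  have h1 : ∫ s in Set.Iic t, (φ s).toReal ∂expMeasure c = Real.exp (-(c * t)) *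
      ∫ u in (0 : ℝ)..t, c * Real.exp (c * u) * (H u.toNNReal).toReal := by
    have hpdf : Measurable (gammaPDF 1 c) := (measurable_gammaPDFReal 1 c).ennreal_ofReal
    rw [expMeasure, gammaMeasure, setIntegral_withDensity_eq_setIntegral_toReal_smul hpdf
      (Eventually.of_forall fun _ => ENNReal.ofReal_lt_top) _ measurableSet_Iic]
    have h3 : ∀ s ∈ Set.Iic t, (gammaPDF 1 c s).toReal • (φ s).toReal =
        (Set.Ici 0).indicator (fun s => c * Real.exp (-(c * s)) * (H (t - s).toNNReal).toReal) s := by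
      intro s hs
      have h4 : gammaPDF 1 c s = _ := exponentialPDF_eq c s
      rw [h4]
      by_cases hs0 : 0 ≤ s
      · rw [if_pos hs0, Set.indicator_of_mem (by exact hs0), ENNReal.toReal_ofReal (by positivity)]
        simp only [φ]
        rw [if_pos (by exact hs), NNReal.sub_def, Real.coe_toNNReal _ ht, Real.coe_toNNReal _ hs0, smul_eq_mul]
      · rw [if_neg hs0, Set.indicator_of_notMem (by exact hs0)]
        simp
    rw [setIntegral_congr_fun measurableSet_Iic h3, setIntegral_indicator measurableSet_Ici,
      Set.inter_comm, Set.Ici_inter_Iic, integral_Icc_eq_integral_Ioc,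
      ← intervalIntegral.integral_of_le ht, ← intervalIntegral.integral_const_mul]
    have h5 := intervalIntegral.integral_comp_sub_left (a := 0) (b := t) (fun u =>
      Real.exp (-(c * t)) * (c * Real.exp (c * u) * (H u.toNNReal).toReal)) t
    rw [sub_self, sub_zero] at h5
    rw [← h5]
    refine intervalIntegral.integral_congr fun s _ => ?_
    have h6 : Real.exp (-(c * s)) = Real.exp (-(c * t)) * Real.exp (c * (t - s)) := by
      rw [← Real.exp_add]; ring_nf
    simp only [h6]
    ring
  rw [h1, h2]
  ring

/-- A one-sided bound suffices: on singletons it gives limsup ≤ liminf. The error `τ s` does not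
depend on `S`, so letting `t` grow and then taking the supremum over `S` bounds the limit mass below
by `1 - τ s`. -/
theorem exists_pmf_tendsto {α ι : Type*} [Preorder ι] [IsDirectedOrder ι] [Nonempty ι]
    {f : ι → α → ℝ≥0∞} (hsum : ∀ t, ∑' a, f t a = 1) {τ : ι → ℝ≥0∞}
    (hτ : Tendsto τ atTop (𝓝 0))
    (h : ∀ s t, s ≤ t → ∀ S : Finset α, ∑ a ∈ S, f s a ≤ ∑ a ∈ S, f t a + τ s) :
    ∃ π : PMF α, ∀ a, Tendsto (fun t => f t a) atTop (𝓝 (π a)) := by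
  have hlim : ∀ a, Tendsto (fun t => f t a) atTop (𝓝 (liminf (fun t => f t a) atTop)) := by
    intro a
    have h1 : ∀ s, f s a ≤ liminf (fun t => f t a) atTop + τ s := by
      intro s
      rw [← tsub_le_iff_right]
      refine le_liminf_of_le (by isBoundedDefault) ?_
      filter_upwards [eventually_ge_atTop s] with t ht
      rw [tsub_le_iff_right]
      simpa using h s t ht {a}
    refine tendsto_of_le_liminf_of_limsup_le le_rfl ?_
    have h2 : Tendsto (fun s => liminf (fun t => f t a) atTop + τ s) atTop
        (𝓝 (liminf (fun t => f t a) atTop)) := by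
      simpa using hτ.const_add (liminf (fun t => f t a) atTop)
    exact (limsup_le_limsup (Eventually.of_forall h1)).trans h2.limsup_eq.le
  set π : α → ℝ≥0∞ := fun a => liminf (fun t => f t a) atTop
  have hS : ∀ S : Finset α, Tendsto (fun t => ∑ a ∈ S, f t a) atTop (𝓝 (∑ a ∈ S, π a)) :=
    fun S => tendsto_finsetSum S fun a _ => hlim a
  have hle : ∑' a, π a ≤ 1 := by
    rw [ENNReal.tsum_eq_iSup_sum]
    exact iSup_le fun S => le_of_tendsto' (hS S) fun t =>
      (ENNReal.sum_le_tsum S).trans (hsum t).le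
  have hge : 1 ≤ ∑' a, π a := by
    have h1 : ∀ s, 1 ≤ ∑' a, π a + τ s := by
      intro s
      rw [← hsum s, ENNReal.tsum_eq_iSup_sum]
      refine iSup_le fun S => ?_
      refine le_trans ?_ (add_le_add_left (ENNReal.sum_le_tsum S) (τ s))
      refine ge_of_tendsto ((hS S).add_const (τ s)) ?_
      filter_upwards [eventually_ge_atTop s] with t ht using h s t ht S
    have h2 := hτ.const_add (∑' a, π a)
    rw [add_zero] at h2
    exact ge_of_tendsto' h2 h1
  exact ⟨⟨π, le_antisymm hle hge ▸ ENNReal.summable.hasSum⟩, hlim⟩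

theorem meanBatch_le_meanTotalBatch {J : ℕ} (p : PMF (Fin J → ℕ)) (j : Fin J) :
    meanBatch p j ≤ meanTotalBatch p := by
  refine ENNReal.tsum_le_tsum fun n => ?_
  gcongr
  exact Finset.single_le_sum (f := fun j => n j) (fun _ _ => Nat.zero_le _) (Finset.mem_univ j)

/-! ### Finiteness of the queues and ergodicity -/

namespace BatchNetwork

variable {Ω : Type*} {m : MeasurableSpace Ω} [MeasurableSpace Ω] {P : Measure Ω} {J : ℕ} {rate : ℝ}
  {p : PMF (Fin J → ℕ)} {q : Fin J → Fin J → ℝ≥0 → ℝ≥0∞}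

theorem interarrival_le_T (N : BatchNetwork P J rate p q) (i : ℕ) (ω : Ω) :
    interarrival N.T i ω ≤ N.T i ω := by
  cases i with
  | zero => exact le_rfl
  | succ i => exact sub_le_self _ (N.T i ω).2

/-- If no arrival exceeds `t`, then neither does any of the first `n` gaps; by independence this has
geometrically small probability. -/
theorem ae_exists_lt_T (hrate : 0 < rate) (N : BatchNetwork P J rate p q) (t : ℝ≥0) :
    ∀ᵐ ω ∂P, ∃ i, t < N.T i ω := by
  have hr : expMeasure rate (Set.Iic (t : ℝ)) < 1 := by
    rw [expMeasure_Iic hrate, ENNReal.ofReal_lt_one]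
    linarith [Real.exp_pos (-(rate * t))]
  have hinj : Function.Injective (RandomSource.gap : ℕ → RandomSource J) := fun i i' h => by
    simpa using h
  have hle : ∀ n : ℕ, P {ω | ¬ ∃ i, t < N.T i ω} ≤ expMeasure rate (Set.Iic (t : ℝ)) ^ n := by
    intro n
    have h1 := (N.indep.precomp hinj).meas_biInter (S := Finset.range n)
      (s := fun i => interarrival N.T i ⁻¹' Set.Iic (t : ℝ))
      fun i _ => ⟨_, measurableSet_Iic, rfl⟩
    have h2 : ∀ i, P (interarrival N.T i ⁻¹' Set.Iic (t : ℝ)) =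
        expMeasure rate (Set.Iic (t : ℝ)) := fun i => by
      rw [← N.law_gap i, Measure.map_apply (N.measurable_interarrival i) measurableSet_Iic]
    simp only [h2, Finset.prod_const, Finset.card_range] at h1
    rw [← h1]
    refine measure_mono fun ω hω => Set.mem_iInter₂.2 fun i _ => ?_
    simp only [Set.mem_ofPred_eq, not_exists, not_lt] at hω
    exact (N.interarrival_le_T i ω).trans (NNReal.coe_le_coe.2 (hω i))
  exact le_antisymm (ge_of_tendsto' (ENNReal.tendsto_pow_atTop_nhds_zero_of_lt_one hr) hle)
    zero_le

theorem ae_monotone_T (N : BatchNetwork P J rate p q) :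
    ∀ᵐ ω ∂P, Monotone fun i => N.T i ω := by
  filter_upwards [N.ae_interarrival_nonneg] with ω hω
  refine monotone_nat_of_le_succ fun i => ?_
  have := hω (i + 1)
  rw [interarrival, sub_nonneg] at this
  exact_mod_cast this

/-- Almost surely only finitely many batches arrive by time `t`. This excludes the value `∞`, so
that the integer states carry total mass one. -/
theorem ae_occVec_eq_natCast (hrate : 0 < rate) (N : BatchNetwork P J rate p q) (t : ℝ≥0) :
    ∀ᵐ ω ∂P, ∃ n : Fin J → ℕ, N.occVec t ω = fun k => (n k : ℝ≥0∞) := by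
  filter_upwards [N.ae_monotone_T, N.ae_exists_lt_T hrate t] with ω hmono ⟨i₀, hi₀⟩
  refine ⟨fun k => ∑ i ∈ Finset.range i₀,
    if N.T i ω ≤ t then N.batchCount i k (t - N.T i ω) ω else 0, funext fun k => ?_⟩
  rw [occVec, occupancy, tsum_eq_sum (s := Finset.range i₀), Nat.cast_sum]
  · exact Finset.sum_congr rfl fun i _ => by split_ifs <;> simp
  · intro i hi
    exact if_neg (not_le.2 (hi₀.trans_le (hmono (by simpa using hi))))

theorem tsum_occProb_singleton (hrate : 0 < rate) [IsProbabilityMeasure P]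
    (N : BatchNetwork P J rate p q) (t : ℝ≥0) :
    ∑' n : Fin J → ℕ, N.occProb {fun k => (n k : ℝ≥0∞)} t = 1 := by
  have hm : ∀ n : Fin J → ℕ, MeasurableSet {ω | N.occVec t ω ∈ ({fun k => (n k : ℝ≥0∞)} : Set _)} :=
    fun n => (N.measurable_occVec_at t) (measurableSet_singleton _)
  simp only [occProb]
  rw [← measure_iUnion (fun n n' hn => ?_) hm]
  · refine (prob_compl_eq_zero_iff (MeasurableSet.iUnion hm)).1 ?_
    filter_upwards [N.ae_occVec_eq_natCast hrate t] with ω ⟨n, hn⟩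
    exact Set.mem_iUnion.2 ⟨n, hn⟩
  · rw [Function.onFun, Set.disjoint_left]
    intro ω h1 h2
    have h3 := (Set.mem_singleton_iff.1 h1).symm.trans (Set.mem_singleton_iff.1 h2)
    exact hn (funext fun k => by exact_mod_cast congrFun h3 k)

theorem sum_occProb_singleton (N : BatchNetwork P J rate p q) (S : Finset (Fin J → ℕ)) (t : ℝ≥0) :
    ∑ n ∈ S, N.occProb {fun k => (n k : ℝ≥0∞)} t =
      N.occProb ((fun (n : Fin J → ℕ) k => (n k : ℝ≥0∞)) '' S) t := by
  have hm : ∀ n : Fin J → ℕ, MeasurableSet {ω | N.occVec t ω ∈ ({fun k => (n k : ℝ≥0∞)} : Set _)} :=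
    fun n => (N.measurable_occVec_at t) (measurableSet_singleton _)
  simp only [occProb]
  rw [← measure_biUnion_finset (fun n _ n' _ hn => ?_) fun n _ => hm n]
  · congr 1
    ext ω
    simp [eq_comm]
  · rw [Function.onFun, Set.disjoint_left]
    intro ω h1 h2
    have h3 := (Set.mem_singleton_iff.1 h1).symm.trans (Set.mem_singleton_iff.1 h2)
    exact hn (funext fun k => by exact_mod_cast congrFun h3 k)

theorem q_le_one [IsProbabilityMeasure P] (N : BatchNetwork P J rate p q) (j k : Fin J) (t : ℝ≥0) :
    q j k t ≤ 1 :=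
  N.law_location 0 j 0 t k ▸ prob_le_one

/-- The mean number of customers of a batch that are in the network at age `u`. -/
noncomputable def _root_.meanBatchInNetwork (p : PMF (Fin J → ℕ))
    (q : Fin J → Fin J → ℝ≥0 → ℝ≥0∞) (u : ℝ) : ℝ≥0∞ :=
  ∑ j, meanBatch p j * networkTail q j u.toNNReal

theorem meanBatchInNetwork_lt_top [IsProbabilityMeasure P] (N : BatchNetwork P J rate p q)
    (hS : meanTotalBatch p < ∞) (u : ℝ) : meanBatchInNetwork p q u < ∞ :=
  ENNReal.sum_lt_top.2 fun j _ => ENNReal.mul_lt_top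
    ((meanBatch_le_meanTotalBatch p j).trans_lt hS)
    (ENNReal.sum_lt_top.2 fun k _ => (N.q_le_one j k _).trans_lt ENNReal.one_lt_top)

theorem integrableOn_meanBatchInNetwork [IsProbabilityMeasure P] (N : BatchNetwork P J rate p q)
    (hQ : ∀ j, meanNetworkTime q j < ∞) (hS : meanTotalBatch p < ∞) :
    IntegrableOn (fun u => (meanBatchInNetwork p q u).toReal) (Set.Ioi 0) := by
  have hq : ∀ j, Measurable fun u : ℝ => networkTail q j u.toNNReal := fun j =>
    Finset.measurable_sum _ fun k _ => (N.measurable_q j k).comp measurable_real_toNNReal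
  have hm : Measurable (meanBatchInNetwork p q) :=
    Finset.measurable_sum _ fun j _ => (hq j).const_mul _
  refine integrable_toReal_of_lintegral_ne_top hm.aemeasurable (ne_of_lt ?_)
  simp only [meanBatchInNetwork]
  rw [lintegral_finsetSum _ fun j _ => (hq j).const_mul _]
  refine ENNReal.sum_lt_top.2 fun j _ => ?_
  rw [lintegral_const_mul _ (hq j)]
  exact ENNReal.mul_lt_top ((meanBatch_le_meanTotalBatch p j).trans_lt hS) (hQ j)

theorem abs_occProb_sub_le [IsProbabilityMeasure P] (hrate : 0 < rate)
    (N : BatchNetwork P J rate p q) (hQ : ∀ j, meanNetworkTime q j < ∞)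
    (hS : meanTotalBatch p < ∞) {A : Set (Fin J → ℝ≥0∞)} (hA : MeasurableSet A) {s t : ℝ≥0}
    (hst : s ≤ t) :
    |(N.occProb A t).toReal - (N.occProb A s).toReal| ≤
      rate * ∫ u in (s : ℝ)..t, (meanBatchInNetwork p q u).toReal := by
  have hstep1 : ∀ u, N.stepProb A u ≤ 1 := fun u => prob_le_one
  have hocc1 : ∀ u, N.occProb A u ≤ 1 := fun u => prob_le_one
  have key := abs_sub_le_of_renewal (a := (A.indicator (1 : (Fin J → ℝ≥0∞) → ℝ≥0∞) 0).toReal)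
    (h := fun u => (N.stepProb A u.toNNReal).toReal)
    (f := fun u => (N.occProb A u.toNNReal).toReal)
    (e := fun u => (meanBatchInNetwork p q u).toReal) (s := s) (t := t) hrate
    ((N.measurable_stepProb hA).comp measurable_real_toNNReal).ennreal_toReal
    (fun u => by
      rw [abs_of_nonneg ENNReal.toReal_nonneg]
      exact ENNReal.toReal_mono ENNReal.one_ne_top (hstep1 _))
    (fun u hu => by
      have h := toReal_lintegral_expMeasure_ite hrate (N.measurable_stepProb hA) hstep1
        (b := A.indicator 1 0) (Set.indicator_le_self' (fun _ _ => zero_le) _) hu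
      rw [← h, N.occProb_eq_lintegral hA, Real.coe_toNNReal _ hu])
    (fun u hu => by
      have hb := N.measure_batchVec_ne_zero_le 0 u.toNNReal
      have h1 := (N.stepProb_le hrate hA u.toNNReal).trans (add_le_add_right hb _)
      have h2 := (N.occProb_le_stepProb hrate hA u.toNNReal).trans (add_le_add_right hb _)
      have ht : ∑ j, meanBatch p j * networkTail q j u.toNNReal ≠ ∞ :=
        (N.meanBatchInNetwork_lt_top hS u).ne
      have hs' := ((hstep1 u.toNNReal).trans_lt ENNReal.one_lt_top).ne
      have ho' := ((hocc1 u.toNNReal).trans_lt ENNReal.one_lt_top).ne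
      have h3 := ENNReal.toReal_mono (ENNReal.add_ne_top.2 ⟨ho', ht⟩) h1
      have h4 := ENNReal.toReal_mono (ENNReal.add_ne_top.2 ⟨hs', ht⟩) h2
      rw [ENNReal.toReal_add ho' ht] at h3
      rw [ENNReal.toReal_add hs' ht] at h4
      rw [abs_sub_le_iff, meanBatchInNetwork]
      constructor <;> linarith)
    s.2 (NNReal.coe_le_coe.2 hst)
    (intervalIntegrable_iff.2 ((N.integrableOn_meanBatchInNetwork hQ hS).mono_set
      fun x hx => lt_of_le_of_lt (le_min s.2 t.2) hx.1))
  simpa using key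

theorem ergodic [IsProbabilityMeasure P] (hrate : 0 < rate)
    (N : BatchNetwork P J rate p q) (hQ : ∀ j, meanNetworkTime q j < ∞)
    (hS : meanTotalBatch p < ∞) : N.Ergodic := by
  set e : ℝ → ℝ := fun u => (meanBatchInNetwork p q u).toReal
  have he : IntegrableOn e (Set.Ioi 0) := N.integrableOn_meanBatchInNetwork hQ hS
  have hii : ∀ s t : ℝ≥0, IntervalIntegrable e volume (s : ℝ) t := fun s t =>
    intervalIntegrable_iff.2 (he.mono_set fun x hx => lt_of_le_of_lt (le_min s.2 t.2) hx.1)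
  -- This is `rate` times the tail integral of `e` beyond `s`: it bounds every later change of
  -- `occProb`, whatever `A` is.
  set τ : ℝ≥0 → ℝ := fun s => rate * ((∫ u in Set.Ioi 0, e u) - ∫ u in (0 : ℝ)..s, e u)
  have hτ : Tendsto τ atTop (𝓝 0) := by
    have h1 := (intervalIntegral_tendsto_integral_Ioi 0 he tendsto_id).comp
      (NNReal.tendsto_coe_atTop.2 (tendsto_id (α := ℝ≥0)))
    have h2 := (h1.const_sub (∫ u in Set.Ioi 0, e u)).const_mul rate
    rw [sub_self, mul_zero] at h2
    exact h2
  have hbound : ∀ s t : ℝ≥0, s ≤ t → ∀ A : Set (Fin J → ℝ≥0∞), MeasurableSet A →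
      N.occProb A s ≤ N.occProb A t + ENNReal.ofReal (τ s) := by
    intro s t hst A hA
    have h1 := N.abs_occProb_sub_le hrate hQ hS hA hst
    have h2 : ∫ u in (s : ℝ)..t, e u ≤ (∫ u in Set.Ioi 0, e u) - ∫ u in (0 : ℝ)..s, e u := by
      have h3 := intervalIntegral.integral_add_adjacent_intervals (hii 0 s) (hii s t)
      have h4 : ∫ u in (0 : ℝ)..t, e u ≤ ∫ u in Set.Ioi 0, e u := by
        rw [intervalIntegral.integral_of_le (NNReal.coe_nonneg t)]
        exact setIntegral_mono_set he (Eventually.of_forall fun _ => ENNReal.toReal_nonneg)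
          Set.Ioc_subset_Ioi_self.eventuallyLE
      rw [NNReal.coe_zero] at h3
      linarith
    have h5 : (N.occProb A s).toReal ≤ (N.occProb A t).toReal + τ s := by
      have := (abs_le.1 h1).1
      have h6 : rate * ∫ u in (s : ℝ)..t, e u ≤ τ s := mul_le_mul_of_nonneg_left h2 hrate.le
      linarith
    have hs' : N.occProb A s ≠ ∞ := measure_ne_top _ _
    have ht' : N.occProb A t ≠ ∞ := measure_ne_top _ _
    rw [← ENNReal.ofReal_toReal hs', ← ENNReal.ofReal_toReal ht']
    exact (ENNReal.ofReal_le_ofReal h5).trans ENNReal.ofReal_add_le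
  obtain ⟨π, hπ⟩ := exists_pmf_tendsto
    (f := fun t (n : Fin J → ℕ) => N.occProb {fun k => (n k : ℝ≥0∞)} t)
    (N.tsum_occProb_singleton hrate) (τ := fun s => ENNReal.ofReal (τ s))
    (by simpa using ENNReal.tendsto_ofReal hτ)
    (fun s t hst S => by
      rw [sum_occProb_singleton, sum_occProb_singleton]
      exact hbound s t hst _ (S.finite_toSet.image _).measurableSet)
  refine ⟨π, fun n => (hπ n).congr fun t => ?_⟩
  rw [occProb]
  congr 1
  ext ω
  simp [occVec, funext_iff]

end BatchNetwork

theorem corollary4p2 {Ω : Type*} [MeasurableSpace Ω] (P : Measure Ω) [IsProbabilityMeasure P]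
    (J : ℕ) (rate : ℝ) (hrate : 0 < rate) (p : PMF (Fin J → ℕ))
    (q : Fin J → Fin J → ℝ≥0 → ℝ≥0∞) (N : BatchNetwork P J rate p q)
    (hQ : ∀ j, meanNetworkTime q j < ∞)
    (hS : meanTotalBatch p < ∞) :
    N.Ergodic ∧
      ∀ i, ∫⁻ ω, N.batchOccupancyTime i ω ∂P ≤
        ∑ j : Fin J, meanBatch p j * meanNetworkTime q j :=
  ⟨N.ergodic hrate hQ hS, N.lintegral_batchOccupancyTime_le⟩
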